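/- Let $R_{m,j}(n)$, for integers $m,j,n\ge 0$, denote the number of pairs $(\mu,\pi)$ of total size $n$ such that $\mu$ is an overpartition (a partition in which the first occurrence of each part size may be overlined) with exactly $j$ parts, all of them even and $\le 2m$, and $\pi$ is a partition into odd parts $\le 2m+1$ in which every odd number $<2m+1$ appears at least once, while $2m+1$ may appear any number of times or not at all. Let $q\in\mathbb{C}$ with $0<|q|<1$, let $q^{1/2}$ be either square root of $q$, and write $q^{k/2}=(q^{1/2})^k$ for integers $k$. Then all the series below converge absolutely, and $$\sum_{m,j,n\ge0}(-1)^{j}R_{m,j}(n)\,q^n=\frac12\sum_{n\ge0}q^{n^2/2}\bigl(1+q^{n+1/2}\bigr)\sum_{|j|\le n}q^{j^2/2}+\frac12\sum_{n\ge0}(-1)^nq^{n^2/2}\bigl(1-q^{n+1/2}\bigr)\sum_{|j|\le n}(-1)^jq^{j^2/2}.$$ -/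

import Mathlib

/-- An overpartition of `n`: a partition of `n` in which the first occurrence of each part size
may be overlined. The finset `overlined` records the part sizes whose first occurrence is
overlined. -/
structure Overpartition (n : ℕ) where
  toPartition : Nat.Partition n
  overlined : Finset ℕ
  overlined_subset : overlined ⊆ toPartition.parts.toFinset

instance Overpartition.instFinite (n : ℕ) : Finite (Overpartition n) := by
  let f : Overpartition n → (Σ p : Nat.Partition n, p.parts.toFinset.powerset) :=
    fun μ => ⟨μ.toPartition, ⟨μ.overlined, Finset.mem_powerset.2 μ.overlined_subset⟩⟩
  refine Finite.of_injective f ?_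
  rintro ⟨p, s, hs⟩ ⟨p', s', hs'⟩ h
  simp only [f, Sigma.mk.injEq] at h
  obtain ⟨rfl, h⟩ := h
  simpa using h

/-- `μ` is an overpartition into exactly `j` parts, each of them even and at most `2 * m`. -/
def IsEvenOverpartition (m j : ℕ) {k : ℕ} (μ : Overpartition k) : Prop :=
  (∀ i ∈ μ.toPartition.parts, Even i ∧ i ≤ 2 * m) ∧ Multiset.card μ.toPartition.parts = j

/-- `π` is a partition into odd parts, each at most `2 * m + 1`, in which every odd number below
`2 * m + 1` appears at least once (and `2 * m + 1` any number of times, possibly zero). -/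
def IsFullOddPartition (m : ℕ) {k : ℕ} (π : Nat.Partition k) : Prop :=
  (∀ i ∈ π.parts, Odd i ∧ i ≤ 2 * m + 1) ∧ ∀ i : ℕ, Odd i → i < 2 * m + 1 → i ∈ π.parts

/-- Pairs of an overpartition and a partition whose sizes add up to `n`. -/
abbrev PartitionPair (n : ℕ) : Type :=
  Σ p : {p : ℕ × ℕ // p.1 + p.2 = n}, Overpartition p.1.1 × Nat.Partition p.1.2

/-- The number `R_{m,j}(n)` of pairs `(μ, π)` of total size `n`, with `μ` an overpartition into
`j` even parts at most `2 * m`, and `π` a partition into odd parts at most `2 * m + 1` in which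
every odd number below `2 * m + 1` appears. -/
noncomputable def pairCount (m j n : ℕ) : ℕ :=
  Nat.card {x : PartitionPair n // IsEvenOverpartition m j x.2.1 ∧ IsFullOddPartition m x.2.2}

/-! Both sides equal the Lambert series L(q) = ∑ 2q^n/(1+q^(2n)), `lambertSum`.

Right side: let T_n be the theta sum over |j| ≤ n. Since T_(n+1) - T_(n-1) = 2(s^(n^2) +
s^((n+1)^2)), the first series telescopes in the products T_n T_(n+1), with value (1 + θ(s)^2)/2.
Jacobi's two-square formula (`thetaSum_sq`) turns this into L(s). The second series is the first at
-s, and the half-sum of L(s) and L(-s) is L(s^2) = L(q) (`lambertSum_add_neg`).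

The two-square formula is the limit of two finite bilateral identities, each proved by induction on
n. With P = (q;q)_∞ and E = (-q;q)_∞, one gives θ(-q) = P/E, the other (2L(-q) - 1)(E/P)^2 = 1.

Left side: for fixed m the pairs are free choices of multiplicities and overlines, so their
generating function with each part of μ weighted by -1 is the product `pairGenFun (-1) q m`
(`hasSum_pairCode`). Summing over m gives L(q) by iterating a first-order recurrence of Fine's type
(`fineSum_rec`), starting from L(q) itself. -/

open Filter Topology

/-! ### Theta series and the telescoping quarter-plane sum -/

/-- The theta series `∑ s ^ (j ^ 2)` over all integers `j`. -/
noncomputable def thetaSum (s : ℂ) : ℂ := ∑' j : ℤ, s ^ (j ^ 2)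

/-- The partial sum of the theta series over `|j| ≤ n`. -/
noncomputable def thetaPartial (s : ℂ) (n : ℕ) : ℂ := ∑ j ∈ Finset.Icc (-(n : ℤ)) (n : ℤ), s ^ (j ^ 2)

lemma summable_pow_sq {r : ℝ} (h0 : 0 ≤ r) (h1 : r < 1) : Summable fun n : ℕ => r ^ (n ^ 2) :=
  Summable.of_nonneg_of_le (fun n => by positivity)
    (fun n => pow_le_pow_of_le_one h0 h1.le (Nat.le_self_pow two_ne_zero n))
    (summable_geometric_of_lt_one h0 h1)

lemma summable_zpow_sq {r : ℝ} (h0 : 0 ≤ r) (h1 : r < 1) : Summable fun j : ℤ => r ^ (j ^ 2) := by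
  have h : Summable fun n : ℕ => r ^ ((n : ℤ) ^ 2) := by
    refine (summable_pow_sq h0 h1).congr fun n => ?_
    exact_mod_cast rfl
  exact Summable.of_nat_of_neg h (by simpa using h)

lemma summable_theta {s : ℂ} (h1 : ‖s‖ < 1) : Summable fun j : ℤ => s ^ (j ^ 2) :=
  Summable.of_norm (by simpa [norm_zpow] using summable_zpow_sq (norm_nonneg s) h1)

lemma tendsto_thetaPartial {s : ℂ} (h1 : ‖s‖ < 1) :
    Tendsto (thetaPartial s) atTop (𝓝 (thetaSum s)) :=
  (summable_theta h1).hasSum.comp (Finset.tendsto_Icc_neg (R := ℤ))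

lemma thetaPartial_succ (s : ℂ) (n : ℕ) :
    thetaPartial s (n + 1) = thetaPartial s n + 2 * s ^ ((n + 1) ^ 2) := by
  have h : Finset.Icc (-((n + 1 : ℕ) : ℤ)) ((n + 1 : ℕ) : ℤ) =
      insert ((n + 1 : ℕ) : ℤ) (insert (-((n + 1 : ℕ) : ℤ)) (Finset.Icc (-(n : ℤ)) (n : ℤ))) := by
    ext x; simp only [Finset.mem_Icc, Finset.mem_insert]; push_cast; omega
  have e : s ^ (((n + 1 : ℕ) : ℤ) ^ 2) = s ^ ((n + 1) ^ 2) := by exact_mod_cast rfl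
  rw [thetaPartial, h, Finset.sum_insert, Finset.sum_insert, neg_sq, e, thetaPartial]
  · ring
  · simp
  · simp only [Finset.mem_Icc, Finset.mem_insert]; push_cast; omega

lemma thetaPartial_zero (s : ℂ) : thetaPartial s 0 = 1 := by simp [thetaPartial]

/-- The telescoping partial sums of the quarter-plane theta series. -/
lemma sum_range_thetaPartial (s : ℂ) (n : ℕ) :
    ∑ k ∈ Finset.range (n + 1), s ^ (k ^ 2) * (1 + s ^ (2 * k + 1)) * thetaPartial s k =
      (1 + thetaPartial s n * thetaPartial s (n + 1)) / 2 := by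
  induction n with
  | zero => simp [thetaPartial_succ, thetaPartial_zero]; ring
  | succ n ih =>
    -- The increment from index n to n+2 is 2(s^((n+1)^2) + s^((n+2)^2)), twice the new weight,
    -- because (n+1)^2 + (2n+3) = (n+2)^2.
    rw [Finset.sum_range_succ, ih, thetaPartial_succ s (n + 1), thetaPartial_succ s n]
    ring

lemma hasSum_thetaPartial {s : ℂ} (h1 : ‖s‖ < 1) :
    HasSum (fun n : ℕ => s ^ (n ^ 2) * (1 + s ^ (2 * n + 1)) * thetaPartial s n)
      ((1 + thetaSum s ^ 2) / 2) := by
  have ht := tendsto_thetaPartial h1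
  obtain ⟨C, hC⟩ := (Metric.isBounded_range_of_tendsto _ ht).exists_norm_le
  have hs : Summable (fun n : ℕ => s ^ (n ^ 2) * (1 + s ^ (2 * n + 1)) * thetaPartial s n) := by
    refine Summable.of_norm_bounded
      (((summable_pow_sq (norm_nonneg s) h1).mul_right 2).mul_right C) fun n => ?_
    rw [norm_mul, norm_mul, norm_pow]
    gcongr
    · refine (norm_add_le _ _).trans ?_
      have := pow_le_one₀ (norm_nonneg s) h1.le (n := 2 * n + 1)
      rw [norm_one, norm_pow]; linarith
    · exact hC _ ⟨n, rfl⟩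
  have h2 := hs.hasSum.tendsto_sum_nat.comp (tendsto_add_atTop_nat 1)
  have h3 : Tendsto (fun n => (1 + thetaPartial s n * thetaPartial s (n + 1)) / 2) atTop
      (𝓝 ((1 + thetaSum s * thetaSum s) / 2)) :=
    ((ht.mul (ht.comp (tendsto_add_atTop_nat 1))).const_add 1).div_const 2
  rw [sq, ← tendsto_nhds_unique h2 (h3.congr fun n => (sum_range_thetaPartial s n).symm)]
  exact hs.hasSum

/-! ### Finite q-products and their limits -/

/-- The finite product `∏_{i < n} (1 - a q ^ i)`. -/
noncomputable def qPoch (a q : ℂ) (n : ℕ) : ℂ := ∏ i ∈ Finset.range n, (1 - a * q ^ i)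

lemma qPoch_zero (a q : ℂ) : qPoch a q 0 = 1 := by simp [qPoch]

lemma qPoch_succ (a q : ℂ) (n : ℕ) : qPoch a q (n + 1) = qPoch a q n * (1 - a * q ^ n) :=
  Finset.prod_range_succ _ _

lemma qPoch_succ' (a q : ℂ) (n : ℕ) : qPoch a q (n + 1) = (1 - a) * qPoch (a * q) q n := by
  rw [qPoch, Finset.prod_range_succ', qPoch, mul_comm]
  simp [pow_succ', mul_assoc]

lemma qPoch_ne_zero {a q : ℂ} (h : ∀ i, 1 - a * q ^ i ≠ 0) (n : ℕ) : qPoch a q n ≠ 0 :=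
  Finset.prod_ne_zero_iff.2 fun i _ => h i

lemma one_sub_mul_pow_ne_zero {a q : ℂ} (ha : ‖a‖ < 1) (hq : ‖q‖ < 1) (i : ℕ) :
    1 - a * q ^ i ≠ 0 := by
  intro h
  have h2 : ‖a * q ^ i‖ < 1 := by
    rw [norm_mul, norm_pow]
    exact (mul_le_of_le_one_right (norm_nonneg _) (pow_le_one₀ (norm_nonneg _) hq.le)).trans_lt ha
  rw [← sub_eq_zero.1 h] at h2
  simp at h2

lemma exists_tendsto_qPoch {a q : ℂ} (hq : ‖q‖ < 1) (h : ∀ i, 1 - a * q ^ i ≠ 0) :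
    ∃ P : ℂ, P ≠ 0 ∧ Tendsto (qPoch a q) atTop (𝓝 P) := by
  have hs : Summable fun i : ℕ => ‖-(a * q ^ i)‖ := by
    simpa using (summable_geometric_of_lt_one (norm_nonneg q) hq).mul_left ‖a‖
  refine ⟨∏' i : ℕ, (1 + -(a * q ^ i)),
    tprod_one_add_ne_zero_of_summable (fun i => by simpa [sub_eq_add_neg] using h i) hs, ?_⟩
  have := (multipliable_one_add_of_summable hs).hasProd.tendsto_prod_nat
  simp only [← sub_eq_add_neg] at this ⊢
  exact this

/-! ### Bilateral sums over zero-extended sequences -/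

/-- Extension of a sequence to the integers by zero on negative integers. -/
noncomputable def zeroExt (f : ℕ → ℂ) (m : ℤ) : ℂ := if m < 0 then 0 else f m.toNat

lemma zeroExt_of_neg (f : ℕ → ℂ) {m : ℤ} (h : m < 0) : zeroExt f m = 0 := if_pos h

lemma zeroExt_natCast (f : ℕ → ℂ) (n : ℕ) : zeroExt f n = f n := by simp [zeroExt]

lemma norm_zeroExt_le {f : ℕ → ℂ} {C : ℝ} (hC : ∀ n, ‖f n‖ ≤ C) (m : ℤ) : ‖zeroExt f m‖ ≤ C := by
  unfold zeroExt
  split_ifs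
  · simpa using (norm_nonneg _).trans (hC 0)
  · exact hC _

lemma tendsto_zeroExt {f : ℕ → ℂ} {P : ℂ} (hf : Tendsto f atTop (𝓝 P)) (k : ℤ) :
    Tendsto (fun n : ℕ => zeroExt f (n + k)) atTop (𝓝 P) := by
  have h1 : Tendsto (fun n : ℕ => ((n : ℤ) + k).toNat) atTop atTop := by
    refine tendsto_atTop.2 fun b => ?_
    filter_upwards [eventually_ge_atTop (b + k.natAbs)] with n hn
    omega
  refine (hf.comp h1).congr' ?_
  filter_upwards [eventually_ge_atTop k.natAbs] with n hn
  rw [zeroExt, if_neg (by omega)]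
  rfl

lemma summable_mul_zeroExt (c : ℤ → ℂ) (f : ℕ → ℂ) (a b : ℤ) :
    Summable fun k : ℤ => c k * (zeroExt f (a - k) * zeroExt f (b + k)) := by
  refine summable_of_ne_finset_zero (s := Finset.Icc (-b) a) fun k hk => ?_
  rw [Finset.mem_Icc, not_and_or, not_le, not_le] at hk
  rcases hk with hk | hk
  · rw [zeroExt_of_neg f (m := b + k) (by omega), mul_zero, mul_zero]
  · rw [zeroExt_of_neg f (m := a - k) (by omega), zero_mul, mul_zero]

/-- Dominated convergence: for fixed k both indices n - k and n + k tend to infinity, and `f` is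
bounded. This carries the finite bilateral identities to their limits. -/
lemma tendsto_tsum_mul_zeroExt {c : ℤ → ℂ} (hc : Summable fun k => ‖c k‖) {f : ℕ → ℂ} {P : ℂ}
    (hf : Tendsto f atTop (𝓝 P)) :
    Tendsto (fun n : ℕ => ∑' k : ℤ, c k * (zeroExt f (n - k) * zeroExt f (n + k))) atTop
      (𝓝 ((∑' k, c k) * (P * P))) := by
  obtain ⟨C, hC⟩ := (Metric.isBounded_range_of_tendsto _ hf).exists_norm_le
  have hC' : ∀ n, ‖f n‖ ≤ C := fun n => hC _ ⟨n, rfl⟩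
  have hC0 : 0 ≤ C := (norm_nonneg _).trans (hC' 0)
  rw [← tsum_mul_right]
  refine tendsto_tsum_of_dominated_convergence (hc.mul_right (C * C)) (fun k => ?_)
    (Eventually.of_forall fun n k => ?_)
  · refine Tendsto.const_mul _ (Tendsto.mul ?_ (tendsto_zeroExt hf k))
    simpa only [sub_eq_add_neg] using tendsto_zeroExt hf (-k)
  · rw [norm_mul, norm_mul]
    gcongr
    · exact norm_zeroExt_le hC' _
    · exact norm_zeroExt_le hC' _

/-- A first-order recurrence on `ℕ` extends to `ℤ` when its coefficient vanishes at `0`. -/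
lemma zeroExt_sub_one {f : ℕ → ℂ} {a b : ℤ → ℂ} (hb : b 0 = 0)
    (h : ∀ n : ℕ, f n * a (n + 1) = f (n + 1) * b (n + 1)) (m : ℤ) :
    zeroExt f (m - 1) * a m = zeroExt f m * b m := by
  rcases lt_trichotomy m 0 with hm | rfl | hm
  · rw [zeroExt_of_neg f hm, zeroExt_of_neg f (by omega), zero_mul, zero_mul]
  · rw [zeroExt_of_neg f (by omega), hb, zero_mul, mul_zero]
  · obtain ⟨n, rfl⟩ : ∃ n : ℕ, m = n + 1 := ⟨(m - 1).toNat, by omega⟩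
    have := zeroExt_natCast f (n + 1)
    push_cast at this
    rw [add_sub_cancel_right, zeroExt_natCast, this, h]

/-! ### Finite Gauss product formula, and products g(z)g(-z) -/

section
variable {q : ℂ}

lemma one_add_zpow_ne_zero (hq1 : ‖q‖ < 1) (m : ℤ) : 1 + q ^ m ≠ 0 := by
  intro h
  have h1 : q ^ m = -1 := by linear_combination h
  have h2 : ‖q‖ ^ m = 1 := by rw [← norm_zpow, h1]; simp
  have h3 := (zpow_eq_one_iff_right₀ (norm_nonneg q) hq1.ne).1 h2
  rw [h3] at h1
  norm_num at h1

lemma one_sub_pow_succ_ne_zero (hq1 : ‖q‖ < 1) (n : ℕ) : 1 - q ^ (n + 1) ≠ 0 := by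
  rw [pow_succ']; exact one_sub_mul_pow_ne_zero hq1 hq1 n

lemma one_add_pow_ne_zero (hq1 : ‖q‖ < 1) (n : ℕ) : 1 + q ^ n ≠ 0 := by
  cases n with
  | zero => norm_num
  | succ n =>
    have := one_sub_mul_pow_ne_zero (a := -q) (by simpa using hq1) hq1 n
    rwa [neg_mul, sub_neg_eq_add, ← pow_succ'] at this

lemma neg_one_zpow_sq_mul (q : ℂ) (k : ℤ) : (-1 : ℂ) ^ k * q ^ (k ^ 2) = (-q) ^ (k ^ 2) := by
  rw [neg_eq_neg_one_mul q, mul_zpow]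
  congr 1
  rcases Int.even_or_odd k with h | h
  · rw [h.neg_one_zpow, (h.pow_of_ne_zero two_ne_zero).neg_one_zpow]
  · rw [h.neg_one_zpow, (h.pow).neg_one_zpow]

/-- Finite form of Gauss's product formula for the theta series. -/
lemma tsum_neg_one_zpow_mul_zeroExt_inv_qPoch (hq0 : q ≠ 0) (hq1 : ‖q‖ < 1) (n : ℕ) :
    ∑' k : ℤ, (-1 : ℂ) ^ k * q ^ (k ^ 2) * (zeroExt (fun m => (qPoch q q m)⁻¹) (n - k) *
      zeroExt (fun m => (qPoch q q m)⁻¹) (n + k)) = (qPoch q q n * qPoch (-q) q n)⁻¹ := by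
  set r := zeroExt (fun m => (qPoch q q m)⁻¹) with hr
  have hrec : ∀ m : ℤ, r (m - 1) = r m * (1 - q ^ m) := by
    intro m
    have := zeroExt_sub_one (f := fun m => (qPoch q q m)⁻¹) (a := fun _ => 1)
      (b := fun m => 1 - q ^ m) (by simp) (fun n => ?_) m
    · simpa using this
    · have h1 : (q : ℂ) ^ ((n : ℤ) + 1) = q * q ^ n := by
        rw [← pow_succ']; exact_mod_cast rfl
      have h2 := one_sub_mul_pow_ne_zero hq1 hq1 n
      simp only [h1, qPoch_succ, mul_inv, mul_one]
      rw [inv_mul_cancel_right₀ h2]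
  induction n with
  | zero =>
    rw [tsum_eq_single 0]
    · have : r 0 = 1 := by simpa [qPoch_zero] using zeroExt_natCast (fun m => (qPoch q q m)⁻¹) 0
      simp [this, qPoch_zero]
    · intro k hk
      rcases lt_or_gt_of_ne hk with hk | hk
      · rw [hr, zeroExt_of_neg _ (m := (0 : ℕ) + k) (by simpa using hk), mul_zero, mul_zero]
      · rw [hr, zeroExt_of_neg _ (m := (0 : ℕ) - k) (by simpa using hk), zero_mul, mul_zero]
  | succ n ih =>
    -- The error term of the step from n to n+1. It is odd under k ↦ -1 - k, which swaps the two `r`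
    -- factors, fixes k^2 + k and flips the sign, so its sum vanishes.
    set E : ℤ → ℂ := fun k => (-1 : ℂ) ^ k * q ^ (k ^ 2 + k) * (r (n - k) * r ((n + 1) + k)) with hE
    have hEs : Summable E := summable_mul_zeroExt _ _ _ _
    have hE0 : ∑' k, E k = 0 := by
      have h1 := (Equiv.subLeft (-1 : ℤ)).tsum_eq E
      have h2 : ∀ k, E (Equiv.subLeft (-1 : ℤ) k) = -E k := by
        intro k
        simp only [hE, Equiv.subLeft_apply]
        rw [show (-1 - k) ^ 2 + (-1 - k) = k ^ 2 + k by ring,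
          show (n : ℤ) - (-1 - k) = n + 1 + k by ring, show (n : ℤ) + 1 + (-1 - k) = n - k by ring,
          zpow_sub₀ (by norm_num), zpow_neg_one]
        rcases Int.even_or_odd k with h | h
        · rw [h.neg_one_zpow]; ring
        · rw [h.neg_one_zpow]; ring
      simp only [h2, tsum_neg] at h1
      linear_combination -h1 / 2
    have hE1 : ∑' k, E (-k) = 0 := by rw [← hE0]; exact (Equiv.neg ℤ).tsum_eq E
    have hEs' : Summable fun k => E (-k) := (Equiv.neg ℤ).summable_iff.2 hEs
    -- With N = n+1: 1 - q^(2N) = (1 - q^(N-k))(1 - q^(N+k)) + q^N (q^k (1 - q^(N-k)) + q^(-k) (1 -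
    -- q^(N+k))), and each factor 1 - q^m lowers an index of `r` by one.
    have key : ∀ k : ℤ, (-1 : ℂ) ^ k * q ^ (k ^ 2) * (r ((n + 1 : ℕ) - k) * r ((n + 1 : ℕ) + k)) *
        (1 - q ^ (2 * (n + 1))) =
        (-1 : ℂ) ^ k * q ^ (k ^ 2) * (r (n - k) * r (n + k)) + q ^ (n + 1) * (E k + E (-k)) := by
      intro k
      have e1 := hrec (n + 1 - k)
      have e2 := hrec (n + 1 + k)
      rw [show (n : ℤ) + 1 - k - 1 = n - k by ring] at e1
      rw [show (n : ℤ) + 1 + k - 1 = n + k by ring] at e2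
      have hx : q ^ k ≠ 0 := zpow_ne_zero _ hq0
      have hN : q ^ ((n : ℤ) + 1) = q ^ (n + 1) := by exact_mod_cast rfl
      rw [zpow_sub₀ hq0, hN] at e1
      rw [zpow_add₀ hq0, hN] at e2
      have h3 : (-1 : ℂ) ^ (-k) = (-1) ^ k := by rw [← inv_zpow']; norm_num
      simp only [hE, h3, neg_sq, sub_neg_eq_add, Nat.cast_add, Nat.cast_one]
      rw [zpow_add₀ hq0, zpow_add₀ hq0, zpow_neg, show (n : ℤ) + 1 + -k = n + 1 - k by ring, e1, e2]
      field_simp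
      ring
    have hS := tsum_congr (L := .unconditional ℤ) key
    rw [tsum_mul_right, Summable.tsum_add (summable_mul_zeroExt _ _ _ _)
      ((hEs.add hEs').mul_left _), tsum_mul_left, hEs.tsum_add hEs', hE0, hE1, ih] at hS
    have h2 := one_sub_pow_succ_ne_zero hq1 n
    have h3 := one_add_pow_ne_zero hq1 (n + 1)
    have h4 : (1 - q ^ (2 * (n + 1))) = (1 - q * q ^ n) * (1 - -q * q ^ n) := by ring
    have h5 : (1 - q * q ^ n) * (1 - -q * q ^ n) ≠ 0 := by
      refine mul_ne_zero ?_ ?_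
      · rwa [← pow_succ']
      · rwa [neg_mul, sub_neg_eq_add, ← pow_succ']
    rw [add_zero, mul_zero, add_zero, h4] at hS
    rw [eq_div_of_mul_eq h5 hS, qPoch_succ, qPoch_succ, div_eq_mul_inv, ← mul_inv]
    congr 1
    ring

/-- If `(1 - z) g(z) = (1 + z) g(q z)` then `g(z) g(-z)` is constant. -/
lemma sum_antidiagonal_neg_one_pow_mul {f : ℕ → ℂ}
    (hf : ∀ n, f (n + 1) * (1 - q ^ (n + 1)) = f n * (1 + q ^ n)) {N : ℕ} (hN : 1 - q ^ N ≠ 0) :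
    ∑ p ∈ Finset.HasAntidiagonal.antidiagonal N, (-1 : ℂ) ^ p.1 * f p.1 * f p.2 = 0 := by
  open PowerSeries in
  set g : PowerSeries ℂ := PowerSeries.mk f with hg
  have h1 : (1 - X) * g = (1 + X) * rescale q g := by
    ext n
    cases n with
    | zero =>
      rw [sub_mul, add_mul, one_mul, one_mul, map_sub, map_add, coeff_zero_X_mul, coeff_zero_X_mul]
      simp only [hg, coeff_rescale, coeff_mk]
      ring
    | succ n =>
      rw [sub_mul, add_mul, one_mul, one_mul, map_sub, map_add, coeff_succ_X_mul, coeff_succ_X_mul]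
      simp only [hg, coeff_rescale, coeff_mk]
      linear_combination hf n
  have h2 := congrArg (rescale (-1 : ℂ)) h1
  simp only [map_mul, map_sub, map_add, map_one, rescale_X, map_neg] at h2
  rw [rescale_rescale, mul_comm q, ← rescale_rescale] at h2
  set P := rescale (-1) g * g with hP
  -- Multiplying the functional equation by its image under z ↦ -z gives the same factor on both
  -- sides; after cancelling it, P(z) = P(qz).
  have h3 : ((1 - X) * (1 + X)) * P = ((1 - X) * (1 + X)) * rescale q P := by
    rw [hP, map_mul]
    linear_combination (1 + X) * rescale (-1 : ℂ) g * h1 + (1 + X) * rescale q g * h2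
  have hX : ((1 - X) * (1 + X) : PowerSeries ℂ) ≠ 0 := by
    intro h
    have := congrArg (coeff 0) h
    simp at this
  have h4 := congrArg (coeff N) (mul_left_cancel₀ hX h3)
  rw [coeff_rescale] at h4
  have h5 : coeff N P = 0 := by
    refine (mul_eq_zero.1 (?_ : (1 - q ^ N) * coeff N P = 0)).resolve_left hN
    linear_combination h4
  rw [hP, coeff_mul] at h5
  simpa [hg, coeff_rescale] using h5

end

/-! ### The Lambert series, its even part and its bilateral form -/

/-- The Lambert series `∑ 2 x ^ n / (1 + x ^ (2 n))`. -/
noncomputable def lambertSum (x : ℂ) : ℂ := ∑' n : ℕ, 2 * x ^ n / (1 + x ^ (2 * n))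

lemma norm_lambert_term_le {x : ℂ} (hx : ‖x‖ < 1) (n : ℕ) :
    ‖2 * x ^ n / (1 + x ^ (2 * n))‖ ≤ 2 / (1 - ‖x‖) * ‖x‖ ^ n := by
  have h0 := norm_nonneg x
  have h1 : 1 - ‖x‖ ≤ ‖1 + x ^ (2 * n)‖ := by
    rcases n with - | n
    · norm_num; linarith
    · have h2 := norm_sub_norm_le (1 : ℂ) (-x ^ (2 * (n + 1)))
      rw [sub_neg_eq_add, norm_neg, norm_pow, norm_one] at h2
      have h3 : ‖x‖ ^ (2 * (n + 1)) ≤ ‖x‖ ^ 1 := pow_le_pow_of_le_one h0 hx.le (by omega)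
      rw [pow_one] at h3
      linarith
  rw [norm_div, norm_mul, norm_pow, Complex.norm_two, div_mul_eq_mul_div]
  have : 0 < 1 - ‖x‖ := by linarith
  gcongr

lemma summable_norm_lambert {x : ℂ} (hx : ‖x‖ < 1) :
    Summable fun n : ℕ => ‖2 * x ^ n / (1 + x ^ (2 * n))‖ :=
  Summable.of_nonneg_of_le (fun _ => norm_nonneg _) (norm_lambert_term_le hx)
    ((summable_geometric_of_lt_one (norm_nonneg x) hx).mul_left _)

/-- Only the even-indexed terms survive in the even part of the Lambert series. -/
lemma lambertSum_add_neg {s : ℂ} (hs : ‖s‖ < 1) :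
    lambertSum s + lambertSum (-s) = 2 * lambertSum (s ^ 2) := by
  have h1 := (summable_norm_lambert hs).of_norm
  have h2 := (summable_norm_lambert (x := -s) (by simpa using hs)).of_norm
  have h3 := (summable_norm_lambert (x := s ^ 2) (by
    rw [norm_pow]; exact pow_lt_one₀ (norm_nonneg s) hs two_ne_zero)).of_norm
  set f : ℕ → ℂ := fun n => 2 * s ^ n / (1 + s ^ (2 * n)) + 2 * (-s) ^ n / (1 + (-s) ^ (2 * n))
    with hf
  have he : ∀ n, f (2 * n) = 2 * (2 * (s ^ 2) ^ n / (1 + (s ^ 2) ^ (2 * n))) := by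
    intro n
    simp only [hf, (even_two_mul n).neg_pow, (even_two_mul (2 * n)).neg_pow, ← pow_mul]
    ring
  have ho : ∀ n, f (2 * n + 1) = 0 := by
    intro n
    simp only [hf, (odd_two_mul_add_one n).neg_pow, (even_two_mul (2 * n + 1)).neg_pow]
    ring
  have he' : HasSum (fun n => f (2 * n)) (2 * lambertSum (s ^ 2)) := by
    simp only [he]; exact h3.hasSum.mul_left 2
  have ho' : HasSum (fun n => f (2 * n + 1)) 0 := by
    simp only [ho]; exact hasSum_zero
  rw [lambertSum, lambertSum, ← h1.tsum_add h2]
  exact (he'.even_add_odd ho').tsum_eq.trans (add_zero _)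

/-- The bilateral form of the Lambert series. -/
lemma summable_and_tsum_int_lambert {x : ℂ} (hx0 : x ≠ 0) (hx : ‖x‖ < 1) :
    (Summable fun k : ℤ => ‖2 * x ^ k / (1 + x ^ (2 * k))‖) ∧
      ∑' k : ℤ, 2 * x ^ k / (1 + x ^ (2 * k)) = 2 * lambertSum x - 1 := by
  have e1 : ∀ n : ℕ, 2 * x ^ (n : ℤ) / (1 + x ^ (2 * (n : ℤ))) = 2 * x ^ n / (1 + x ^ (2 * n)) :=
    fun n => by exact_mod_cast rfl
  have e2 : ∀ n : ℕ, 2 * x ^ (-(n : ℤ)) / (1 + x ^ (2 * (-(n : ℤ)))) =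
      2 * x ^ n / (1 + x ^ (2 * n)) := by
    intro n
    have h : 1 + x ^ (2 * n) ≠ 0 := one_add_pow_ne_zero hx _
    have h' : x ^ (2 * n) + 1 ≠ 0 := by rwa [add_comm]
    rw [mul_neg, zpow_neg, zpow_neg]
    have : x ^ (2 * (n : ℤ)) = x ^ (2 * n) := by exact_mod_cast rfl
    rw [this, zpow_natCast]
    have hn : x ^ n ≠ 0 := pow_ne_zero _ hx0
    rw [pow_mul', sq] at *
    field_simp
    rw [add_comm]
  have hs := summable_norm_lambert hx
  constructor
  · exact Summable.of_nat_of_neg (by simpa only [e1] using hs) (by simpa only [e2] using hs)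
  -- The terms are even in k; the term at k = 0 equals 1 and is counted in both halves, whence the
  -- -1.
  · rw [Summable.tsum_of_nat_of_neg (by simpa only [e1] using hs.of_norm)
      (by simpa only [e2] using hs.of_norm)]
    simp only [e1, e2]
    rw [lambertSum]
    norm_num
    ring

/-! ### Jacobi's two-square formula -/

section
variable {q : ℂ}

/-- Up to the sign (-1)^N this is the coefficient of z^(2N) in g(-z)g(z), reindexed by i = N + k. -/
lemma tsum_neg_one_zpow_mul_zeroExt {f : ℕ → ℂ}
    (hf : ∀ n, f (n + 1) * (1 - q ^ (n + 1)) = f n * (1 + q ^ n)) {N : ℕ} (hN : 1 - q ^ (2 * N) ≠ 0) :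
    ∑' k : ℤ, (-1 : ℂ) ^ k * (zeroExt f (N - k) * zeroExt f (N + k)) = 0 := by
  have h1 := sum_antidiagonal_neg_one_pow_mul hf hN
  rw [Finset.Nat.sum_antidiagonal_eq_sum_range_succ
    (fun i j => (-1 : ℂ) ^ i * f i * f j)] at h1
  rw [← (Equiv.subRight (N : ℤ)).tsum_eq, tsum_eq_sum (s := (Finset.range (2 * N).succ).map
    ⟨((↑) : ℕ → ℤ), Nat.cast_injective⟩), Finset.sum_map]
  · rw [← mul_zero ((-1 : ℂ) ^ N), ← h1, Finset.mul_sum]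
    refine Finset.sum_congr rfl fun i hi => ?_
    have hi' : i ≤ 2 * N := Nat.lt_succ_iff.1 (Finset.mem_range.1 hi)
    simp only [Function.Embedding.coeFn_mk, Equiv.subRight_apply]
    rw [show (N : ℤ) - (i - N) = ((2 * N - i : ℕ) : ℤ) by omega,
      show (N : ℤ) + (i - N) = (i : ℤ) by omega, zeroExt_natCast, zeroExt_natCast,
      zpow_sub₀ (by norm_num), zpow_natCast, zpow_natCast]
    have : ((-1 : ℂ) ^ N) * (-1) ^ N = 1 := by rw [← mul_pow]; norm_num
    have h2 : ((-1 : ℂ) ^ N) ≠ 0 := pow_ne_zero _ (by norm_num)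
    field_simp
    linear_combination -(f i * f (2 * N - i)) * this
  · intro k hk
    simp only [Equiv.subRight_apply]
    by_cases h : k < 0
    · rw [zeroExt_of_neg f (m := (N : ℤ) + (k - N)) (by omega), mul_zero, mul_zero]
    · by_cases h' : (2 * N : ℤ) < k
      · rw [zeroExt_of_neg f (m := (N : ℤ) - (k - N)) (by omega), zero_mul, mul_zero]
      · refine absurd (Finset.mem_map.2 ⟨k.toNat, ?_, ?_⟩) hk
        · rw [Finset.mem_range]; omega
        · simp only [Function.Embedding.coeFn_mk]; omega

/-- Finite form of Jacobi's two-square formula. -/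
lemma tsum_lambert_mul_zeroExt (hq0 : q ≠ 0) (hq1 : ‖q‖ < 1) (n : ℕ) :
    ∑' k : ℤ, 2 * (-q) ^ k / (1 + (-q) ^ (2 * k)) *
      (zeroExt (fun m => qPoch (-q) q m / qPoch q q m) (n - k) *
        zeroExt (fun m => qPoch (-q) q m / qPoch q q m) (n + k)) = 1 := by
  set B : ℕ → ℂ := fun m => qPoch (-q) q m / qPoch q q m with hB
  -- Dividing out 1 + q^m makes both `B` at m and `B` at m - 1 multiples of `H` at m, by 1 + q^m and
  -- 1 - q^m respectively.
  set H : ℕ → ℂ := fun m => B m / (1 + q ^ m) with hH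
  have hBs : ∀ m, B (m + 1) * (1 - q ^ (m + 1)) = B m * (1 + q ^ (m + 1)) := by
    intro m
    have h1 := one_sub_pow_succ_ne_zero hq1 m
    have h2 := qPoch_ne_zero (one_sub_mul_pow_ne_zero hq1 hq1) m
    simp only [hB, qPoch_succ, ← pow_succ', neg_mul, sub_neg_eq_add]
    field_simp
  have hHs : ∀ m, H (m + 1) * (1 - q ^ (m + 1)) = H m * (1 + q ^ m) := by
    intro m
    have h1 := one_add_pow_ne_zero hq1 (m + 1)
    have h2 := one_add_pow_ne_zero hq1 m
    simp only [hH]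
    rw [div_mul_eq_mul_div, hBs, mul_div_cancel_right₀ _ h1, div_mul_cancel₀ _ h2]
  have hBH : ∀ m : ℤ, zeroExt B m = zeroExt H m * (1 + q ^ m) := by
    intro m
    rcases lt_or_ge m 0 with h | h
    · rw [zeroExt_of_neg _ h, zeroExt_of_neg _ h, zero_mul]
    · obtain ⟨k, rfl⟩ := Int.eq_ofNat_of_zero_le h
      rw [zeroExt_natCast, zeroExt_natCast, zpow_natCast, div_mul_cancel₀ _ (one_add_pow_ne_zero hq1 k)]
  have hB1 : ∀ m : ℤ, zeroExt B (m - 1) = zeroExt H m * (1 - q ^ m) := by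
    intro m
    have h := zeroExt_sub_one (f := B) (a := fun m => 1 + q ^ m) (b := fun m => 1 - q ^ m) (by simp)
      (fun n => by
        have e : q ^ ((n : ℤ) + 1) = q ^ (n + 1) := by exact_mod_cast rfl
        rw [e]; exact (hBs n).symm) m
    have h1 := one_add_zpow_ne_zero hq1 m
    rw [hBH m] at h
    apply mul_right_cancel₀ h1
    rw [h]; ring
  induction n with
  | zero =>
    rw [tsum_eq_single 0]
    · have : zeroExt B 0 = 1 := by simpa [hB, qPoch_zero] using zeroExt_natCast B 0
      norm_num [this]
    · intro k hk
      rcases lt_or_gt_of_ne hk with hk | hk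
      · rw [zeroExt_of_neg _ (m := (0 : ℕ) + k) (by simpa using hk), mul_zero, mul_zero]
      · rw [zeroExt_of_neg _ (m := (0 : ℕ) - k) (by simpa using hk), zero_mul, mul_zero]
  | succ n ih =>
    -- With N = n+1: (1 + q^(N-k))(1 + q^(N+k)) - (1 - q^(N-k))(1 - q^(N+k)) = 2q^(N-k)(1 + q^(2k)).
    -- This cancels the Lambert denominator and leaves the alternating sum of products of `H`, which
    -- is zero.
    have key : ∀ k : ℤ, 2 * (-q) ^ k / (1 + (-q) ^ (2 * k)) *
        (zeroExt B ((n + 1 : ℕ) - k) * zeroExt B ((n + 1 : ℕ) + k)) =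
        2 * (-q) ^ k / (1 + (-q) ^ (2 * k)) * (zeroExt B (n - k) * zeroExt B (n + k)) +
        4 * q ^ (n + 1) *
          ((-1) ^ k * (zeroExt H ((n + 1 : ℕ) - k) * zeroExt H ((n + 1 : ℕ) + k))) := by
      intro k
      have e1 := hB1 ((n + 1 : ℕ) - k)
      have e2 := hB1 ((n + 1 : ℕ) + k)
      rw [show ((n + 1 : ℕ) : ℤ) - k - 1 = n - k by push_cast; ring] at e1
      rw [show ((n + 1 : ℕ) : ℤ) + k - 1 = n + k by push_cast; ring] at e2
      have hx : q ^ k ≠ 0 := zpow_ne_zero _ hq0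
      have hd : 1 + (q ^ k) ^ 2 ≠ 0 := by
        have := one_add_zpow_ne_zero hq1 (2 * k)
        rwa [mul_comm, zpow_mul, zpow_ofNat] at this
      have e3 : (-q) ^ (2 * k) = (q ^ k) ^ 2 := by
        rw [(even_two_mul k).neg_zpow, mul_comm, zpow_mul, zpow_ofNat]
      have e4 : (-q) ^ k = (-1) ^ k * q ^ k := by rw [neg_eq_neg_one_mul q, mul_zpow]
      rw [e1, e2, hBH ((n + 1 : ℕ) - k), hBH ((n + 1 : ℕ) + k), zpow_sub₀ hq0, zpow_add₀ hq0,
        zpow_natCast, e3, e4]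
      field_simp
      ring
    have hN : 1 - q ^ (2 * (n + 1)) ≠ 0 := one_sub_pow_succ_ne_zero hq1 (2 * n + 1)
    rw [tsum_congr key, Summable.tsum_add (summable_mul_zeroExt _ _ _ _)
      ((summable_mul_zeroExt _ _ _ _).mul_left _), tsum_mul_left,
      tsum_neg_one_zpow_mul_zeroExt hHs hN, ih, mul_zero, add_zero]

/-- **Jacobi's two-square formula**: the square of the theta series is a Lambert series. -/
theorem thetaSum_sq {x : ℂ} (hx0 : x ≠ 0) (hx1 : ‖x‖ < 1) :
    thetaSum x ^ 2 = 2 * lambertSum x - 1 := by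
  obtain ⟨q, rfl⟩ : ∃ q, x = -q := ⟨-x, by simp⟩
  have hq0 : q ≠ 0 := by simpa using hx0
  have hq1 : ‖q‖ < 1 := by simpa using hx1
  obtain ⟨hs, ht⟩ := summable_and_tsum_int_lambert hx0 hx1
  obtain ⟨P, hP0, hP⟩ := exists_tendsto_qPoch (a := q) hq1 (one_sub_mul_pow_ne_zero hq1 hq1)
  obtain ⟨E, hE0, hE⟩ := exists_tendsto_qPoch (a := -q) hq1 (one_sub_mul_pow_ne_zero hx1 hq1)
  have h1 := tendsto_tsum_mul_zeroExt hs (hE.div hP hP0)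
  have hc : (Summable fun k : ℤ => ‖(-1 : ℂ) ^ k * q ^ (k ^ 2)‖) := by
    simpa [norm_zpow] using summable_zpow_sq (norm_nonneg q) hq1
  have h2 := tendsto_tsum_mul_zeroExt hc (hP.inv₀ hP0)
  have h3 : (∑' k : ℤ, 2 * (-q) ^ k / (1 + (-q) ^ (2 * k))) * (E / P * (E / P)) = 1 := by
    refine tendsto_nhds_unique h1 (tendsto_const_nhds.congr fun n => ?_)
    exact (tsum_lambert_mul_zeroExt hq0 hq1 n).symm
  have h4 : (∑' k : ℤ, (-1 : ℂ) ^ k * q ^ (k ^ 2)) * (P⁻¹ * P⁻¹) = (P * E)⁻¹ := by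
    refine tendsto_nhds_unique h2 (((hP.mul hE).inv₀ (mul_ne_zero hP0 hE0)).congr fun n => ?_)
    exact (tsum_neg_one_zpow_mul_zeroExt_inv_qPoch hq0 hq1 n).symm
  simp only [neg_one_zpow_sq_mul] at h4
  rw [ht] at h3
  rw [← thetaSum] at h4
  have h5 : thetaSum (-q) = P / E := by
    field_simp at h4 ⊢
    linear_combination h4
  rw [h5]
  field_simp at h3 ⊢
  linear_combination -h3

end

/-- The quarter-plane theta series is a Lambert series. -/
lemma hasSum_thetaPartial_lambert {s : ℂ} (h0 : s ≠ 0) (h1 : ‖s‖ < 1) :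
    HasSum (fun n : ℕ => s ^ (n ^ 2) * (1 + s ^ (2 * n + 1)) * thetaPartial s n)
      (lambertSum s) := by
  have h := hasSum_thetaPartial h1
  rw [thetaSum_sq h0 h1] at h
  convert h using 1
  ring

/-! ### Fine's transformation by iterated recurrence -/

section
variable {q : ℂ}

/-- The ratio `(-1; Q)_n / (-Q ^ (k + 1); Q)_n`. -/
noncomputable def fineCoeff (Q : ℂ) (k n : ℕ) : ℂ :=
  qPoch (-1) Q n * qPoch (-Q) Q k * (qPoch (-Q) Q (k + n))⁻¹

lemma one_sub_neg_mul_pow_ne_zero {Q : ℂ} (hQ : ‖Q‖ < 1) (n : ℕ) : 1 - -Q * Q ^ n ≠ 0 :=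
  one_sub_mul_pow_ne_zero (by simpa using hQ) hQ n

/-- Uniformity in k matters: the remainder of the iteration involves `fineSum q M` with M growing.
-/
lemma exists_norm_fineCoeff_le {Q : ℂ} (hQ : ‖Q‖ < 1) : ∃ C, ∀ k n, ‖fineCoeff Q k n‖ ≤ C := by
  have h1 : ∀ i : ℕ, 1 - (-1) * Q ^ i ≠ 0 := fun i => by
    simpa using one_add_pow_ne_zero hQ i
  obtain ⟨P, -, hP⟩ := exists_tendsto_qPoch hQ h1
  obtain ⟨E, hE0, hE⟩ := exists_tendsto_qPoch hQ (one_sub_neg_mul_pow_ne_zero hQ)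
  obtain ⟨C1, h1⟩ := (Metric.isBounded_range_of_tendsto _ hP).exists_norm_le
  obtain ⟨C2, h2⟩ := (Metric.isBounded_range_of_tendsto _ hE).exists_norm_le
  obtain ⟨C3, h3⟩ := (Metric.isBounded_range_of_tendsto _ (hE.inv₀ hE0)).exists_norm_le
  have p1 : 0 ≤ C1 := (norm_nonneg _).trans (h1 _ ⟨0, rfl⟩)
  have p2 : 0 ≤ C2 := (norm_nonneg _).trans (h2 _ ⟨0, rfl⟩)
  refine ⟨C1 * C2 * C3, fun k n => ?_⟩
  rw [fineCoeff, norm_mul, norm_mul]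
  gcongr
  · exact h1 _ ⟨n, rfl⟩
  · exact h2 _ ⟨k, rfl⟩
  · exact h3 _ ⟨k + n, rfl⟩

lemma fineCoeff_zero {Q : ℂ} (hQ : ‖Q‖ < 1) (k : ℕ) : fineCoeff Q k 0 = 1 := by
  have := qPoch_ne_zero (one_sub_neg_mul_pow_ne_zero hQ) k
  rw [fineCoeff, qPoch_zero, add_zero, one_mul, mul_inv_cancel₀ this]

lemma fineCoeff_zero_left {Q : ℂ} (hQ : ‖Q‖ < 1) (n : ℕ) : fineCoeff Q 0 n = 2 / (1 + Q ^ n) := by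
  have h1 := qPoch_ne_zero (one_sub_neg_mul_pow_ne_zero hQ) n
  have h2 := one_add_pow_ne_zero hQ n
  have h3 := qPoch_succ (-1) Q n
  rw [qPoch_succ'] at h3
  rw [neg_one_mul] at h3
  rw [fineCoeff, qPoch_zero, mul_one, zero_add, eq_div_iff h2, ← div_eq_mul_inv,
    div_mul_eq_mul_div, div_eq_iff h1]
  linear_combination -h3

/-- The factor Q^n, with Q = q^2, moves the argument of the series from q^(2k+1) to q^(2k+3), that
is, from k to k+1. -/
lemma fineCoeff_succ_sub {Q : ℂ} (hQ : ‖Q‖ < 1) (k n : ℕ) :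
    fineCoeff Q k (n + 1) - fineCoeff Q k n =
      Q ^ n * ((1 - Q ^ (k + 1)) / (1 + Q ^ (k + 1))) * fineCoeff Q (k + 1) n := by
  have h1 := qPoch_ne_zero (one_sub_neg_mul_pow_ne_zero hQ) (k + n)
  have h2 := one_add_pow_ne_zero hQ (k + 1)
  have h3 := one_add_pow_ne_zero hQ (k + n + 1)
  have e : ∀ j, 1 - -Q * Q ^ j = 1 + Q ^ (j + 1) := fun j => by ring
  rw [fineCoeff, fineCoeff, fineCoeff, show k + 1 + n = k + n + 1 by ring, ← add_assoc,
    qPoch_succ (-1), qPoch_succ (-Q) Q k, qPoch_succ (-Q) Q (k + n), e, e]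
  field_simp
  ring

/-- The series `∑ fineCoeff Q k n * (q ^ (2 k + 1)) ^ n` with `Q = q ^ 2`. -/
noncomputable def fineSum (q : ℂ) (k : ℕ) : ℂ :=
  ∑' n : ℕ, fineCoeff (q ^ 2) k n * (q ^ (2 * k + 1)) ^ n

lemma norm_sq_lt_one (hq : ‖q‖ < 1) : ‖q ^ 2‖ < 1 := by
  rw [norm_pow]; exact pow_lt_one₀ (norm_nonneg q) hq two_ne_zero

lemma fineSum_zero (hq : ‖q‖ < 1) : fineSum q 0 = lambertSum q := by
  refine tsum_congr fun n => ?_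
  rw [fineCoeff_zero_left (norm_sq_lt_one hq), ← pow_mul q 2]
  ring

lemma exists_norm_fineSum_le (hq : ‖q‖ < 1) :
    (∀ k, Summable fun n : ℕ => fineCoeff (q ^ 2) k n * (q ^ (2 * k + 1)) ^ n) ∧
      ∃ C, ∀ k, ‖fineSum q k‖ ≤ C := by
  obtain ⟨C, hC⟩ := exists_norm_fineCoeff_le (norm_sq_lt_one hq)
  have hC0 : 0 ≤ C := (norm_nonneg _).trans (hC 0 0)
  have hb : ∀ k n, ‖fineCoeff (q ^ 2) k n * (q ^ (2 * k + 1)) ^ n‖ ≤ C * ‖q‖ ^ n := by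
    intro k n
    rw [norm_mul, norm_pow, norm_pow]
    gcongr
    · exact hC k n
    · exact (pow_le_pow_of_le_one (norm_nonneg q) hq.le (by omega : 1 ≤ 2 * k + 1)).trans_eq
        (pow_one _)
  have hs := (summable_geometric_of_lt_one (norm_nonneg q) hq).mul_left C
  exact ⟨fun k => Summable.of_norm_bounded hs (hb k), _,
    fun k => tsum_of_norm_bounded hs.hasSum (hb k)⟩

/-- Multiplying the series by 1 minus its argument replaces the coefficients by their successive
differences, which are multiples of those at k+1; the leading 1 is the constant term. -/
lemma fineSum_rec (hq : ‖q‖ < 1) (k : ℕ) :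
    fineSum q k * (1 - q ^ (2 * k + 1)) =
      1 + (1 - (q ^ 2) ^ (k + 1)) / (1 + (q ^ 2) ^ (k + 1)) * q ^ (2 * k + 1) *
        fineSum q (k + 1) := by
  have hQ := norm_sq_lt_one hq
  have hs := (exists_norm_fineSum_le hq).1 k
  have h1 : fineSum q k = 1 + ∑' n : ℕ, fineCoeff (q ^ 2) k (n + 1) * (q ^ (2 * k + 1)) ^ (n + 1) := by
    rw [fineSum, hs.tsum_eq_zero_add, fineCoeff_zero hQ, pow_zero, one_mul]
  have h2 : fineSum q k * q ^ (2 * k + 1) =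
      ∑' n : ℕ, fineCoeff (q ^ 2) k n * (q ^ (2 * k + 1)) ^ (n + 1) := by
    rw [fineSum, ← tsum_mul_right]
    exact tsum_congr fun n => by ring
  have hs1 : Summable fun n : ℕ => fineCoeff (q ^ 2) k (n + 1) * (q ^ (2 * k + 1)) ^ (n + 1) :=
    (summable_nat_add_iff 1).2 hs
  have hs2 : Summable fun n : ℕ => fineCoeff (q ^ 2) k n * (q ^ (2 * k + 1)) ^ (n + 1) :=
    (hs.mul_right (q ^ (2 * k + 1))).congr fun n => by ring
  rw [mul_sub, mul_one, h2, h1, add_sub_assoc, ← hs1.tsum_sub hs2, fineSum, ← tsum_mul_left]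
  congr 1
  refine tsum_congr fun n => ?_
  rw [← sub_mul, fineCoeff_succ_sub hQ]
  have : q ^ (2 * (k + 1) + 1) = q ^ 2 * q ^ (2 * k + 1) := by ring
  rw [this, mul_pow (q ^ 2) (q ^ (2 * k + 1)) n]
  ring

lemma one_sub_mul_sq_pow_ne_zero (hq : ‖q‖ < 1) (i : ℕ) : 1 - q * (q ^ 2) ^ i ≠ 0 :=
  one_sub_mul_pow_ne_zero hq (norm_sq_lt_one hq) i

/-- M-fold use of `fineSum_rec` from k = 0. The exponents 1 + 3 + ... + (2M-1) accumulate to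
q^(M^2), which kills the remainder in the limit. -/
lemma sum_range_add_fineSum (hq : ‖q‖ < 1) (M : ℕ) :
    ∑ m ∈ Finset.range M, q ^ (m ^ 2) * qPoch (q ^ 2) (q ^ 2) m /
        (qPoch (-q ^ 2) (q ^ 2) m * qPoch q (q ^ 2) (m + 1)) +
      q ^ (M ^ 2) * (qPoch (q ^ 2) (q ^ 2) M /
        (qPoch (-q ^ 2) (q ^ 2) M * qPoch q (q ^ 2) M)) * fineSum q M = lambertSum q := by
  induction M with
  | zero => simp [qPoch_zero, fineSum_zero hq]
  | succ M ih =>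
    rw [Finset.sum_range_succ, ← ih, add_assoc]
    congr 1
    have h1 := qPoch_ne_zero (one_sub_neg_mul_pow_ne_zero (norm_sq_lt_one hq)) M
    have h2 := qPoch_ne_zero (one_sub_mul_sq_pow_ne_zero hq) M
    have h3 : 1 - q ^ (2 * M + 1) ≠ 0 := one_sub_pow_succ_ne_zero hq _
    have h4 := one_add_pow_ne_zero (norm_sq_lt_one hq) (M + 1)
    have e1 : 1 - -q ^ 2 * (q ^ 2) ^ M = 1 + (q ^ 2) ^ (M + 1) := by ring
    have e2 : 1 - q * (q ^ 2) ^ M = 1 - q ^ (2 * M + 1) := by ring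
    have e3 : 1 - q ^ 2 * (q ^ 2) ^ M = 1 - (q ^ 2) ^ (M + 1) := by ring
    have hr := fineSum_rec hq M
    rw [← eq_div_iff h3] at hr
    rw [hr, qPoch_succ q, qPoch_succ (-q ^ 2), qPoch_succ (q ^ 2), e1, e2, e3]
    have e4 : q ^ ((M + 1) ^ 2) = q ^ (M ^ 2) * q ^ (2 * M + 1) := by ring
    rw [e4]
    field_simp

/-- A case of Fine's transformation for basic hypergeometric series. -/
lemma tendsto_sum_range_lambertSum (hq : ‖q‖ < 1) :
    Tendsto (fun M => ∑ m ∈ Finset.range M, q ^ (m ^ 2) * qPoch (q ^ 2) (q ^ 2) m /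
        (qPoch (-q ^ 2) (q ^ 2) m * qPoch q (q ^ 2) (m + 1))) atTop (𝓝 (lambertSum q)) := by
  have hQ := norm_sq_lt_one hq
  obtain ⟨P, -, hP⟩ := exists_tendsto_qPoch hQ (one_sub_mul_pow_ne_zero hQ hQ)
  obtain ⟨E, hE0, hE⟩ := exists_tendsto_qPoch hQ (one_sub_neg_mul_pow_ne_zero hQ)
  obtain ⟨D, hD0, hD⟩ := exists_tendsto_qPoch hQ (one_sub_mul_sq_pow_ne_zero hq)
  obtain ⟨C, hC⟩ := (exists_norm_fineSum_le hq).2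
  have h0 : Tendsto (fun M : ℕ => q ^ (M ^ 2)) atTop (𝓝 0) :=
    (Summable.of_norm (by simpa using summable_pow_sq (norm_nonneg q) hq)).tendsto_atTop_zero
  have h1 := h0.mul (hP.div (hE.mul hD) (mul_ne_zero hE0 hD0))
  rw [zero_mul] at h1
  have h2 := h1.zero_mul_isBoundedUnder_le (g := fineSum q)
    ⟨C, eventually_map.2 (Eventually.of_forall hC)⟩
  have h3 := (tendsto_const_nhds (x := lambertSum q)).sub h2
  rw [sub_zero] at h3
  refine h3.congr fun M => ?_
  rw [← sum_range_add_fineSum hq M]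
  exact add_sub_cancel_right _ _

end

/-! ### Encoding the pairs by multiplicities -/

/-- The multiset in which `f i` is repeated `c i` times. -/
def blockSum {k : ℕ} (f c : Fin k → ℕ) : Multiset ℕ := ∑ i, Multiset.replicate (c i) (f i)

section
variable {k : ℕ} {f : Fin k → ℕ}

lemma count_blockSum (hf : Function.Injective f) (c : Fin k → ℕ) (i : Fin k) :
    (blockSum f c).count (f i) = c i := by
  rw [blockSum, Multiset.count_sum', Finset.sum_eq_single i]
  · simp
  · intro j _ hj
    rw [Multiset.count_replicate, if_neg fun h => hj (hf h)]
  · simp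

lemma mem_blockSum {c : Fin k → ℕ} {x : ℕ} : x ∈ blockSum f c ↔ ∃ i, c i ≠ 0 ∧ f i = x := by
  rw [blockSum, Multiset.mem_sum]
  simp only [Finset.mem_univ, true_and, Multiset.mem_replicate, eq_comm]

lemma card_blockSum (c : Fin k → ℕ) : (blockSum f c).card = ∑ i, c i := by
  simp [blockSum]

lemma sum_blockSum (c : Fin k → ℕ) : (blockSum f c).sum = ∑ i, f i * c i := by
  simp only [blockSum, Multiset.sum_sum, Multiset.sum_replicate, smul_eq_mul, mul_comm]

lemma blockSum_count (hf : Function.Injective f) {M : Multiset ℕ} (hM : ∀ x ∈ M, ∃ i, f i = x) :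
    blockSum f (fun i => M.count (f i)) = M := by
  ext x
  by_cases hx : ∃ i, f i = x
  · obtain ⟨i, rfl⟩ := hx
    exact count_blockSum hf _ i
  · rw [Multiset.count_eq_zero.2 fun h => hx (hM x h), Multiset.count_eq_zero.2]
    rw [mem_blockSum]
    exact fun ⟨i, _, h⟩ => hx ⟨i, h⟩

end

/-- Encoding of the pairs counted by `pairCount m`: for each even part size the number of
non-overlined copies and whether there is an overlined one, and for each odd part size the number
of copies beyond the compulsory one. -/
abbrev PairCode (m : ℕ) : Type := (Fin m → ℕ × Bool) × (Fin (m + 1) → ℕ)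

namespace PairCode
variable {m : ℕ}

def evenPart (i : Fin m) : ℕ := 2 * (i + 1)

def oddPart (i : Fin (m + 1)) : ℕ := 2 * i + 1

/-- The compulsory number of copies of an odd part. -/
def forced (i : Fin (m + 1)) : ℕ := if (i : ℕ) < m then 1 else 0

lemma evenPart_injective : Function.Injective (evenPart (m := m)) := by
  intro i j h
  simp only [evenPart] at h
  exact Fin.ext (by omega)

lemma oddPart_injective : Function.Injective (oddPart (m := m)) := by
  intro i j h
  simp only [oddPart] at h
  exact Fin.ext (by omega)

def evenParts (d : PairCode m) : Multiset ℕ :=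
  blockSum evenPart fun i => (d.1 i).1 + (d.1 i).2.toNat

def oddParts (d : PairCode m) : Multiset ℕ := blockSum oddPart fun i => d.2 i + forced i

def overlinedParts (d : PairCode m) : Finset ℕ :=
  (Finset.univ.filter fun i => (d.1 i).2 = true).image evenPart

lemma evenPart_mem_overlinedParts (d : PairCode m) (i : Fin m) :
    evenPart i ∈ d.overlinedParts ↔ (d.1 i).2 = true := by
  rw [overlinedParts, evenPart_injective.mem_finset_image]
  simp

/-- The number of parts of the overpartition. -/
def numParts (d : PairCode m) : ℕ := d.evenParts.card

/-- The total size of the pair. -/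
def size (d : PairCode m) : ℕ := d.evenParts.sum + d.oddParts.sum

/-- The overpartition encoded by `d`. -/
def overpartition (d : PairCode m) : Overpartition d.evenParts.sum where
  toPartition :=
    { parts := d.evenParts
      parts_pos := fun {x} hx => by
        obtain ⟨i, -, rfl⟩ := mem_blockSum.1 hx
        simp [evenPart]
      parts_sum := rfl }
  overlined := d.overlinedParts
  overlined_subset := by
    intro x hx
    obtain ⟨i, hi, rfl⟩ := Finset.mem_image.1 hx
    refine Multiset.mem_toFinset.2 (mem_blockSum.2 ⟨i, ?_, rfl⟩)
    simp [(Finset.mem_filter.1 hi).2]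

/-- The odd partition encoded by `d`. -/
def oddPartition (d : PairCode m) : Nat.Partition d.oddParts.sum where
  parts := d.oddParts
  parts_pos := fun {x} hx => by
    obtain ⟨i, -, rfl⟩ := mem_blockSum.1 hx
    simp [oddPart]
  parts_sum := rfl

lemma isEvenOverpartition (d : PairCode m) : IsEvenOverpartition m d.numParts d.overpartition := by
  refine ⟨fun x hx => ?_, rfl⟩
  obtain ⟨i, -, rfl⟩ := mem_blockSum.1 hx
  exact ⟨even_two_mul _, by have := i.2; simp only [evenPart]; omega⟩

lemma isFullOddPartition (d : PairCode m) : IsFullOddPartition m d.oddPartition := by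
  refine ⟨fun x hx => ?_, fun x hx hxm => ?_⟩
  · obtain ⟨i, -, rfl⟩ := mem_blockSum.1 hx
    exact ⟨odd_two_mul_add_one _, by have := i.2; simp only [oddPart]; omega⟩
  · obtain ⟨a, rfl⟩ := hx
    refine mem_blockSum.2 ⟨⟨a, by omega⟩, ?_, rfl⟩
    simp [forced, show a < m by omega]

lemma ext_parts {d d' : PairCode m} (h1 : d.evenParts = d'.evenParts)
    (h2 : d.overlinedParts = d'.overlinedParts) (h3 : d.oddParts = d'.oddParts) : d = d' := by
  refine Prod.ext (funext fun i => ?_) (funext fun i => ?_)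
  · have hb : (d.1 i).2 = (d'.1 i).2 := by
      rw [Bool.eq_iff_iff, ← evenPart_mem_overlinedParts, h2, evenPart_mem_overlinedParts]
    have hc := congrArg (Multiset.count (evenPart i)) h1
    rw [evenParts, evenParts, count_blockSum evenPart_injective,
      count_blockSum evenPart_injective, hb] at hc
    exact Prod.ext (by omega) hb
  · have hc := congrArg (Multiset.count (oddPart i)) h3
    rw [oddParts, oddParts, count_blockSum oddPart_injective,
      count_blockSum oddPart_injective] at hc
    omega

/-- Stated for bare multisets, so that `equivPairs` can substitute the parts before meeting
partitions whose types depend on their sizes. -/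
lemma exists_of_parts {M P : Multiset ℕ} {O : Finset ℕ} (hpos : ∀ i ∈ M, 0 < i)
    (hM : ∀ i ∈ M, Even i ∧ i ≤ 2 * m) (hO : O ⊆ M.toFinset)
    (hP : ∀ i ∈ P, Odd i ∧ i ≤ 2 * m + 1) (hP' : ∀ i, Odd i → i < 2 * m + 1 → i ∈ P) :
    ∃ d : PairCode m, d.evenParts = M ∧ d.overlinedParts = O ∧ d.oddParts = P := by
  have hMr : ∀ x ∈ M, ∃ i : Fin m, evenPart i = x := by
    intro x hx
    obtain ⟨⟨a, rfl⟩, h⟩ := hM x hx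
    have := hpos _ hx
    exact ⟨⟨a - 1, by omega⟩, by simp only [evenPart]; omega⟩
  have hPr : ∀ x ∈ P, ∃ i : Fin (m + 1), oddPart i = x := by
    intro x hx
    obtain ⟨⟨a, rfl⟩, h⟩ := hP x hx
    exact ⟨⟨a, by omega⟩, rfl⟩
  -- The truncated subtractions lose nothing: an overlined size occurs in `M`, and a compulsory odd
  -- size occurs in `P`.
  refine ⟨(fun i => (M.count (evenPart i) - (decide (evenPart i ∈ O)).toNat,
    decide (evenPart i ∈ O)), fun i => P.count (oddPart i) - forced i), ?_, ?_, ?_⟩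
  · rw [evenParts]
    conv_rhs => rw [← blockSum_count evenPart_injective hMr]
    congr 1
    funext i
    by_cases h : evenPart i ∈ O
    · have := Multiset.count_pos.2 (Multiset.mem_toFinset.1 (hO h))
      simp only [h, decide_true, Bool.toNat_true]
      omega
    · simp [h]
  · ext x
    constructor
    · intro hx
      obtain ⟨i, hi, rfl⟩ := Finset.mem_image.1 hx
      simpa using (Finset.mem_filter.1 hi).2
    · intro hx
      obtain ⟨i, rfl⟩ := hMr x (Multiset.mem_toFinset.1 (hO hx))
      rw [evenPart_mem_overlinedParts]
      simpa using hx
  · rw [oddParts]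
    conv_rhs => rw [← blockSum_count oddPart_injective hPr]
    congr 1
    funext i
    simp only [forced]
    split_ifs with h
    · have := Multiset.count_pos.2 (hP' (oddPart i) (odd_two_mul_add_one _)
        (by simp only [oddPart]; omega))
      omega
    · omega

/-- The codes with `j` even parts and size `n` correspond to the pairs counted by `pairCount`. -/
noncomputable def equivPairs (m j n : ℕ) : {d : PairCode m // (d.numParts, d.size) = (j, n)} ≃
    {x : PartitionPair n // IsEvenOverpartition m j x.2.1 ∧ IsFullOddPartition m x.2.2} :=
  Equiv.ofBijective
    (fun d => ⟨⟨⟨(d.1.evenParts.sum, d.1.oddParts.sum), (Prod.ext_iff.1 d.2).2⟩,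
      d.1.overpartition, d.1.oddPartition⟩,
      ⟨d.1.isEvenOverpartition.1, (Prod.ext_iff.1 d.2).1⟩,
      d.1.isFullOddPartition⟩) <| by
    constructor
    · intro d d' h
      refine Subtype.ext (ext_parts ?_ ?_ ?_)
      · exact congrArg (fun x => x.1.2.1.toPartition.parts) h
      · exact congrArg (fun x => x.1.2.1.overlined) h
      · exact congrArg (fun x => x.1.2.2.parts) h
    · rintro ⟨⟨⟨⟨k, l⟩, hkl⟩, ⟨⟨M, hM, hMs⟩, O, hO⟩, ⟨P, hP, hPs⟩⟩, ⟨h1, hj⟩, h2, h3⟩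
      obtain ⟨d, rfl, rfl, rfl⟩ := exists_of_parts (m := m) (fun i hi => hM hi) h1 hO h2 h3
      dsimp only at hMs hPs
      subst hMs hPs
      exact ⟨⟨d, Prod.ext hj hkl⟩, rfl⟩

end PairCode

instance PartitionPair.instFinite (n : ℕ) : Finite (PartitionPair n) := by
  have : Finite {p : ℕ × ℕ // p.1 + p.2 = n} :=
    Finite.of_injective (β := Fin (n + 1) × Fin (n + 1))
      (fun p => (⟨p.1.1, by have := p.2; omega⟩, ⟨p.1.2, by have := p.2; omega⟩)) (by
        rintro ⟨⟨a, b⟩, h⟩ ⟨⟨a', b'⟩, h'⟩ e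
        simpa using e)
  infer_instance

/-! ### Generating functions of the codes -/

/-- A product of sums is the sum of the products over all choice functions. -/
lemma hasSum_pi_prod {β : Type*} {k : ℕ} {f : Fin k → β → ℂ} {a : Fin k → ℂ}
    (hf : ∀ i, HasSum (f i) (a i)) (hn : ∀ i, Summable fun b => ‖f i b‖) :
    HasSum (fun x : Fin k → β => ∏ i, f i (x i)) (∏ i, a i) ∧
      Summable fun x : Fin k → β => ‖∏ i, f i (x i)‖ := by
  induction k with
  | zero => exact ⟨by simp,
      Summable.of_finite⟩
  | succ k ih =>
    obtain ⟨h1, h2⟩ := ih (fun i => hf i.succ) (fun i => hn i.succ)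
    have h3 := summable_mul_of_summable_norm (hn 0) h2
    have h4 := (hf 0).mul h1 h3
    have h5 := (hn 0).mul_norm h2
    have e : ∀ p : β × (Fin k → β), (fun x : Fin (k + 1) → β => ∏ i, f i (x i))
        (Fin.consEquiv (fun _ => β) p) = f 0 p.1 * ∏ i, f (Fin.succ i) (p.2 i) := fun p => by
      simp [Fin.prod_univ_succ]
    rw [Fin.prod_univ_succ, ← (Fin.consEquiv fun _ => β).hasSum_iff,
      ← (Fin.consEquiv fun _ => β).summable_iff]
    refine ⟨by simpa only [Function.comp_def, e] using h4, h5.congr fun p => ?_⟩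
    rw [← e]
    rfl

/-- The contribution of one even part size: a geometric series for the plain copies times 1 + x for
the optional overlined one. -/
lemma hasSum_pow_add_toNat {x : ℂ} (hx : ‖x‖ < 1) :
    HasSum (fun p : ℕ × Bool => x ^ (p.1 + p.2.toNat)) ((1 + x) / (1 - x)) ∧
      Summable fun p : ℕ × Bool => ‖x ^ (p.1 + p.2.toNat)‖ := by
  have h1 := hasSum_geometric_of_norm_lt_one hx
  have h2 : HasSum (fun b : Bool => x ^ b.toNat) (1 + x) := by
    have := hasSum_fintype fun b : Bool => x ^ b.toNat
    simpa [add_comm] using this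
  have h1n : Summable fun n : ℕ => ‖x ^ n‖ := by
    simpa using summable_geometric_of_lt_one (norm_nonneg x) hx
  have h2n : Summable fun b : Bool => ‖x ^ b.toNat‖ := Summable.of_finite
  have hs := summable_mul_of_summable_norm h1n h2n
  have h3 := h1.mul h2 hs
  have h4 := h1n.mul_norm h2n
  simp only [← pow_add] at h3 h4
  refine ⟨?_, h4⟩
  rwa [div_eq_inv_mul]

lemma hasSum_pow_add {x : ℂ} (hx : ‖x‖ < 1) (c : ℕ) :
    HasSum (fun n : ℕ => x ^ (n + c)) (x ^ c / (1 - x)) ∧ Summable fun n : ℕ => ‖x ^ (n + c)‖ := by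
  constructor
  · simp only [pow_add, div_eq_inv_mul]
    exact (hasSum_geometric_of_norm_lt_one hx).mul_right _
  · simp only [pow_add, norm_mul]
    refine Summable.mul_right _ ?_
    simpa using summable_geometric_of_lt_one (norm_nonneg x) hx

/-- The generating function of `pairCount m`, with `z` marking the number of even parts. -/
noncomputable def pairGenFun (z q : ℂ) (m : ℕ) : ℂ :=
  q ^ (m ^ 2) * qPoch (-z * q ^ 2) (q ^ 2) m / (qPoch (z * q ^ 2) (q ^ 2) m * qPoch q (q ^ 2) (m + 1))

section
variable {z q : ℂ}

/-- The compulsory copies have total size 1 + 3 + ... + (2m-1) = m^2. -/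
lemma prod_pow_forced (q : ℂ) (m : ℕ) :
    ∏ i : Fin (m + 1), (q ^ (PairCode.oddPart i)) ^ (PairCode.forced i) = q ^ (m ^ 2) := by
  rw [Fin.prod_univ_castSucc]
  simp only [PairCode.oddPart, PairCode.forced, Fin.val_castSucc, Fin.is_lt, if_true, Fin.val_last,
    lt_irrefl, if_false, pow_zero, mul_one, pow_one]
  rw [Fin.prod_univ_eq_prod_range (fun i => q ^ (2 * i + 1)) m]
  induction m with
  | zero => simp
  | succ m ih => rw [Finset.prod_range_succ, ih, ← pow_add]; ring_nf

lemma hasSum_pairCode (hz : ‖z‖ ≤ 1) (hq : ‖q‖ < 1) (m : ℕ) :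
    HasSum (fun d : PairCode m => z ^ d.numParts * q ^ d.size) (pairGenFun z q m) ∧
      Summable fun d : PairCode m => ‖z ^ d.numParts * q ^ d.size‖ := by
  have hpow : ∀ n, ‖q ^ (n + 1)‖ < 1 := fun n => by
    rw [norm_pow]; exact pow_lt_one₀ (norm_nonneg q) hq n.succ_ne_zero
  have hx : ∀ i : Fin m, ‖z * q ^ (PairCode.evenPart i)‖ < 1 := fun i => by
    rw [norm_mul]
    exact (mul_le_of_le_one_left (norm_nonneg _) hz).trans_lt (hpow _)
  have hy : ∀ i : Fin (m + 1), ‖q ^ (PairCode.oddPart i)‖ < 1 := fun i => hpow _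
  obtain ⟨h1, h1n⟩ := hasSum_pi_prod (fun i => (hasSum_pow_add_toNat (hx i)).1)
    (fun i => (hasSum_pow_add_toNat (hx i)).2)
  obtain ⟨h2, h2n⟩ := hasSum_pi_prod (fun i => (hasSum_pow_add (hy i) (PairCode.forced i)).1)
    (fun i => (hasSum_pow_add (hy i) (PairCode.forced i)).2)
  have hs := summable_mul_of_summable_norm h1n h2n
  have h3 := h1.mul h2 hs
  have h4 := h1n.mul_norm h2n
  have e : ∀ d : PairCode m, (∏ i, (z * q ^ (PairCode.evenPart i)) ^ ((d.1 i).1 + (d.1 i).2.toNat)) *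
      ∏ i, (q ^ (PairCode.oddPart i)) ^ (d.2 i + PairCode.forced i) =
      z ^ d.numParts * q ^ d.size := by
    intro d
    simp only [mul_pow, Finset.prod_mul_distrib, ← pow_mul]
    rw [Finset.prod_pow_eq_pow_sum, Finset.prod_pow_eq_pow_sum, Finset.prod_pow_eq_pow_sum,
      PairCode.numParts, PairCode.size, PairCode.evenParts, PairCode.oddParts, card_blockSum,
      sum_blockSum, sum_blockSum, pow_add, mul_assoc]
  simp only [e] at h3 h4
  refine ⟨?_, h4⟩
  suffices hv : pairGenFun z q m =
      (∏ i : Fin m, (1 + z * q ^ PairCode.evenPart i) / (1 - z * q ^ PairCode.evenPart i)) *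
      ∏ i : Fin (m + 1), (q ^ PairCode.oddPart i) ^ PairCode.forced i /
        (1 - q ^ PairCode.oddPart i) by rw [hv]; exact h3
  rw [Finset.prod_div_distrib, Finset.prod_div_distrib, prod_pow_forced, pairGenFun,
    div_mul_div_comm, mul_comm (q ^ (m ^ 2))]
  simp only [PairCode.evenPart, PairCode.oddPart, qPoch]
  rw [Fin.prod_univ_eq_prod_range (fun i => 1 + z * q ^ (2 * (i + 1))) m,
    Fin.prod_univ_eq_prod_range (fun i => 1 - z * q ^ (2 * (i + 1))) m,
    Fin.prod_univ_eq_prod_range (fun i => 1 - q ^ (2 * i + 1)) (m + 1)]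
  have e1 : ∀ i, 1 - -z * q ^ 2 * (q ^ 2) ^ i = 1 + z * q ^ (2 * (i + 1)) := fun i => by ring
  have e2 : ∀ i, 1 - z * q ^ 2 * (q ^ 2) ^ i = 1 - z * q ^ (2 * (i + 1)) := fun i => by ring
  have e3 : ∀ i, 1 - q * (q ^ 2) ^ i = 1 - q ^ (2 * i + 1) := fun i => by ring
  simp only [e1, e2, e3]

lemma summable_norm_pairGenFun (hz : ‖z‖ ≤ 1) (hq : ‖q‖ < 1) :
    Summable fun m => ‖pairGenFun z q m‖ := by
  have hQ := norm_sq_lt_one hq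
  have hzq : ‖z * q ^ 2‖ < 1 := by
    rw [norm_mul]; exact (mul_le_of_le_one_left (norm_nonneg _) hz).trans_lt hQ
  obtain ⟨P, -, hP⟩ := exists_tendsto_qPoch (a := -z * q ^ 2) hQ
    (one_sub_mul_pow_ne_zero (by rwa [neg_mul, norm_neg]) hQ)
  obtain ⟨E, hE0, hE⟩ := exists_tendsto_qPoch hQ (one_sub_mul_pow_ne_zero hzq hQ)
  obtain ⟨D, hD0, hD⟩ := exists_tendsto_qPoch hQ (one_sub_mul_sq_pow_ne_zero hq)
  obtain ⟨C, hC⟩ := (Metric.isBounded_range_of_tendsto _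
    (hP.div (hE.mul (hD.comp (tendsto_add_atTop_nat 1))) (mul_ne_zero hE0 hD0))).exists_norm_le
  refine Summable.of_nonneg_of_le (fun _ => norm_nonneg _) (fun m => ?_)
    ((summable_pow_sq (norm_nonneg q) hq).mul_right C)
  rw [pairGenFun, mul_div_assoc, norm_mul, norm_pow]
  gcongr
  exact hC _ ⟨m, rfl⟩

/-- The norms of the terms are the terms for z = 1 at the real point ‖q‖, so their sum over each m
is again a `pairGenFun`, and these are summable in m. -/
lemma summable_pairCode (hq : ‖q‖ < 1) :
    Summable fun d : Σ m, PairCode m => (-1 : ℂ) ^ d.2.numParts * q ^ d.2.size := by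
  refine Summable.of_norm ?_
  have hr : ‖((‖q‖ : ℝ) : ℂ)‖ < 1 := by simpa using hq
  have h : ∀ m, HasSum (fun d : PairCode m => ‖(-1 : ℂ) ^ d.numParts * q ^ d.size‖)
      (pairGenFun 1 (‖q‖ : ℝ) m).re := by
    intro m
    have h1 := Complex.hasSum_re (hasSum_pairCode (z := 1) (by simp) hr m).1
    have h2 : ∀ d : PairCode m, (1 ^ d.numParts * ((‖q‖ : ℝ) : ℂ) ^ d.size).re =
        ‖(-1 : ℂ) ^ d.numParts * q ^ d.size‖ := fun d => by
      rw [one_pow, one_mul, ← Complex.ofReal_pow, Complex.ofReal_re]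
      simp
    simpa only [h2] using h1
  rw [summable_sigma_of_nonneg fun _ => norm_nonneg _]
  refine ⟨fun m => (h m).summable, ?_⟩
  simp only [(h _).tsum_eq]
  exact Summable.of_norm_bounded (summable_norm_pairGenFun (by simp) hr)
    fun m => Complex.abs_re_le_norm _

/-- One absolutely convergent sum over all codes, grouped in two ways: by m it is Fine's series for
L(q); by (m, j, n) each fibre is finite, has `pairCount m j n` elements and a constant summand. -/
lemma hasSum_pairCount (hq : ‖q‖ < 1) :
    HasSum (fun x : ℕ × ℕ × ℕ => (-1 : ℂ) ^ x.2.1 * (pairCount x.1 x.2.1 x.2.2 : ℂ) * q ^ x.2.2)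
      (lambertSum q) := by
  have hS := (summable_pairCode hq).hasSum
  have hm := hS.sigma fun m => (hasSum_pairCode (z := -1) (by simp) hq m).1
  have hL : ∑' d : Σ m, PairCode m, (-1 : ℂ) ^ d.2.numParts * q ^ d.2.size = lambertSum q := by
    refine tendsto_nhds_unique hm.tendsto_sum_nat
      ((tendsto_sum_range_lambertSum hq).congr fun M => Finset.sum_congr rfl fun m _ => ?_)
    simp [pairGenFun]
  rw [hL] at hS
  let e : (Σ x : ℕ × ℕ × ℕ, {d : PairCode x.1 // (d.numParts, d.size) = x.2}) ≃ Σ m, PairCode m :=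
    { toFun := fun y => ⟨y.1.1, y.2.1⟩
      invFun := fun d => ⟨(d.1, d.2.numParts, d.2.size), d.2, rfl⟩
      left_inv := by 
        rintro ⟨⟨m, x⟩, y⟩
        change {d : PairCode m // (d.numParts, d.size) = x} at y
        obtain ⟨d, rfl⟩ := y
        rfl
      right_inv := fun _ => rfl }
  refine (e.hasSum_iff.2 hS).sigma fun x => ?_
  obtain ⟨m, j, n⟩ := x
  have hfin : Finite {d : PairCode m // (d.numParts, d.size) = (j, n)} :=
    Finite.of_equiv _ (PairCode.equivPairs m j n).symm
  have : Fintype {d : PairCode m // (d.numParts, d.size) = (j, n)} := Fintype.ofFinite _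
  have hc : pairCount m j n = Fintype.card {d : PairCode m // (d.numParts, d.size) = (j, n)} := by
    rw [pairCount, ← Nat.card_congr (PairCode.equivPairs m j n), Nat.card_eq_fintype_card]
  have h := hasSum_fintype fun _ : {d : PairCode m // (d.numParts, d.size) = (j, n)} =>
    (-1 : ℂ) ^ j * q ^ n
  rw [Finset.sum_const, Finset.card_univ, ← hc, nsmul_eq_mul] at h
  convert h using 1
  · funext d
    obtain ⟨d, hd⟩ := d
    have hj : d.numParts = j := congrArg Prod.fst hd
    have hn : d.size = n := congrArg Prod.snd hd
    change (-1 : ℂ) ^ d.numParts * q ^ d.size = _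
    rw [hj, hn]
  · ring

end

theorem theorem1p3 (q s : ℂ) (hq0 : 0 < ‖q‖) (hq1 : ‖q‖ < 1) (hs : s ^ 2 = q) :
    Summable (fun n : ℕ => s ^ (n ^ 2) * (1 + s ^ (2 * n + 1)) *
        ∑ j ∈ Finset.Icc (-(n : ℤ)) (n : ℤ), s ^ (j ^ 2)) ∧
    Summable (fun n : ℕ => (-1 : ℂ) ^ n * s ^ (n ^ 2) * (1 - s ^ (2 * n + 1)) *
        ∑ j ∈ Finset.Icc (-(n : ℤ)) (n : ℤ), (-1 : ℂ) ^ j * s ^ (j ^ 2)) ∧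
    HasSum (fun x : ℕ × ℕ × ℕ => (-1 : ℂ) ^ x.2.1 * (pairCount x.1 x.2.1 x.2.2 : ℂ) * q ^ x.2.2)
      (1 / 2 * ∑' n : ℕ, s ^ (n ^ 2) * (1 + s ^ (2 * n + 1)) *
          ∑ j ∈ Finset.Icc (-(n : ℤ)) (n : ℤ), s ^ (j ^ 2) +
       1 / 2 * ∑' n : ℕ, (-1 : ℂ) ^ n * s ^ (n ^ 2) * (1 - s ^ (2 * n + 1)) *
          ∑ j ∈ Finset.Icc (-(n : ℤ)) (n : ℤ), (-1 : ℂ) ^ j * s ^ (j ^ 2)) := by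
  subst hs
  have hs0 : s ≠ 0 := by rintro rfl; simp at hq0
  have hs1 : ‖s‖ < 1 := by
    rw [norm_pow] at hq1
    exact (pow_lt_one_iff_of_nonneg (norm_nonneg s) two_ne_zero).1 hq1
  have h1 := hasSum_thetaPartial_lambert hs0 hs1
  have h2 := hasSum_thetaPartial_lambert (neg_ne_zero.2 hs0) (by rwa [norm_neg])
  -- The signs match because k^2 and k have the same parity and 2n+1 is odd.
  have e : ∀ n : ℕ, (-s) ^ (n ^ 2) * (1 + (-s) ^ (2 * n + 1)) * thetaPartial (-s) n =
      (-1 : ℂ) ^ n * s ^ (n ^ 2) * (1 - s ^ (2 * n + 1)) *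
        ∑ j ∈ Finset.Icc (-(n : ℤ)) (n : ℤ), (-1 : ℂ) ^ j * s ^ (j ^ 2) := by
    intro n
    have h := neg_one_zpow_sq_mul s n
    have h' : (-1 : ℂ) ^ n * s ^ (n ^ 2) = (-s) ^ (n ^ 2) := by exact_mod_cast h
    simp only [neg_one_zpow_sq_mul, h', (odd_two_mul_add_one n).neg_pow, thetaPartial]
    ring
  simp only [e] at h2
  simp only [thetaPartial] at h1
  refine ⟨h1.summable, h2.summable, ?_⟩
  rw [h1.tsum_eq, h2.tsum_eq, ← mul_add, lambertSum_add_neg hs1, ← mul_assoc, one_div,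
    inv_mul_cancel₀ two_ne_zero, one_mul]
  exact hasSum_pairCount hq1
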